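/- Let $a,c\in\mathbb R$ satisfy $c<0<a$ and $c<-a-c<a$, let $y\in[c,-a-c]$, and put $$q=\sqrt{\tfrac{2c+a}{c-a}}\in(0,1),\qquad F(\gamma,q)=\int_0^\gamma\frac{d\alpha}{\sqrt{1-q^2\sin^2\alpha}},\qquad i_y=F\Big(\arcsin\sqrt{\tfrac{c-y}{2c+a}},\,q\Big).$$ Let $\operatorname{am}(\cdot,q)$ be the inverse of $F(\cdot,q):\mathbb R\to\mathbb R$, let $\operatorname{sn}=\sin(\operatorname{am})$, $\operatorname{cn}=\cos(\operatorname{am})$, $\operatorname{dn}=\sqrt{1-q^2\operatorname{sn}^2}$ be the Jacobi elliptic functions with modulus $q$, and let $\mathcal E(t,q)=\int_0^t\operatorname{dn}^2(s,q)\,ds$. Set $$x_0(t)=c-(a+2c)\,\operatorname{sn}^2\Big(\sqrt{\tfrac{a-c}{6}}\,t+i_y,\,q\Big),\qquad u_1(t)=\operatorname{sn}(t,q)\operatorname{cn}(t,q)\operatorname{dn}(t,q),$$ $$u_2(t)=-1+q^2+(2-5q^2+3q^4-2q^6)\operatorname{cn}^2(t,q)+2q^2(q^4-q^2+1)\operatorname{cn}^4(t,q)+\big[(-q^4+3q^2-2)\,t+2(q^4-q^2+1)\,\mathcal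 E(t,q)\big]u_1(t),$$ and, for real constants $\kappa_1,\kappa_2$ with $-\kappa_1\kappa_2\sqrt{\tfrac{a-c}{6}}\,(1-q^2)^2=1$, $$w_j(t)=\kappa_j\,u_j\Big(\sqrt{\tfrac{a-c}{6}}\,t+i_y\Big),\qquad j=1,2.$$ Then $w_1,w_2$ solve $\ddot w=2x_0(t)w$ and have Wronskian $w_1\dot w_2-\dot w_1w_2=1$. Let $(B(t))_{t\ge0}$ be a standard one-dimensional Brownian motion on a complete probability space $(\Omega,\mathcal F,\mathbb P)$, and let $(\mathcal F^B_t)_{t\ge 0}$ be its filtration augmented by the $\mathbb P$-null sets. The stochastic Lamé equation $$\ddot x_1(t)=2x_0(t)x_1(t)+\dot B(t),\qquad x_1(0)=\dot x_1(0)=0,$$ understood as the system $dx_1=\xi_1\,dt$, $d\xi_1=2x_0(t)x_1\,dt+dB(t)$, $x_1(0)=\xi_1(0)=0$ on $[0,\infty)$, has a unique (up to indistinguishability) global strong solution with almost surely continuous paths adapted to $(\mathcal F^B_t)_{t\ge0}$. Moreover $x_1$ is a continuous Gaussian process, and for every $t\ge0$, almost surely, $$x_1(t)=w_2(t)\int_0^tw_1(s)\,dB(s)-w_1(t)\int_0^tw_2(s)\,dB(s)=\int_0^t\mathcal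 K(t,s)\,dB(s),\qquad \mathcal K(t,s)=w_2(t)w_1(s)-w_1(t)w_2(s),$$ the integrals being Wiener integrals. -/

import Mathlib

open MeasureTheory ProbabilityTheory Filter
open scoped NNReal ENNReal Topology

noncomputable section

namespace StochasticLame

/-! ### Jacobi elliptic functions with modulus `q` (real argument, `0 < q < 1`) -/

/-- The incomplete elliptic integral of the first kind
`F(γ, q) = ∫₀^γ dα / √(1 - q² sin² α)`. -/
def ellipticF (γ q : ℝ) : ℝ :=
  ∫ α in (0 : ℝ)..γ, 1 / √(1 - q ^ 2 * Real.sin α ^ 2)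

/-- The Jacobi amplitude: the inverse of `γ ↦ F(γ, q)`, which is a bijection of `ℝ`
when `0 ≤ q < 1`. -/
def am (u q : ℝ) : ℝ := Function.invFun (fun γ : ℝ => ellipticF γ q) u

/-- The Jacobi elliptic sine: `sn(u, q) = sin γ` where `u = F(γ, q)`. -/
def sn (u q : ℝ) : ℝ := Real.sin (am u q)

/-- The Jacobi elliptic cosine. -/
def cn (u q : ℝ) : ℝ := Real.cos (am u q)

/-- The Jacobi delta amplitude. -/
def dn (u q : ℝ) : ℝ := √(1 - q ^ 2 * sn u q ^ 2)

/-- Jacobi's Epsilon function `∫₀^x dn²(t, q) dt`. -/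
def jacobiEpsilon (x q : ℝ) : ℝ := ∫ t in (0 : ℝ)..x, dn t q ^ 2

/-! ### The unperturbed periodic solution and the two Lamé functions -/

/-- The modulus `q = √((2c + a) / (c - a))`. -/
def modulus (a c : ℝ) : ℝ := √((2 * c + a) / (c - a))

/-- The phase `i_y = F(arcsin √((c - y) / (2c + a)), q)`. -/
def phase (a c y : ℝ) : ℝ :=
  ellipticF (Real.arcsin √((c - y) / (2 * c + a))) (modulus a c)

/-- The change of time `t ↦ √((a - c) / 6) t + i_y`. -/
def phaseTime (a c y t : ℝ) : ℝ := √((a - c) / 6) * t + phase a c y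

/-- The periodic solution `x₀(t) = c - (a + 2c) sn²(√((a - c) / 6) t + i_y, q)`. -/
def x₀ (a c y t : ℝ) : ℝ :=
  c - (a + 2 * c) * sn (phaseTime a c y t) (modulus a c) ^ 2

/-- The first Lamé solution `u₁ = sn · cn · dn`. -/
def u₁ (t q : ℝ) : ℝ := sn t q * cn t q * dn t q

/-- The second Lamé solution
`u₂ = α₀ + α₁ cn² + α₂ cn⁴ + (β₀ t + β₁ ℰ(t, q)) u₁`. -/
def u₂ (t q : ℝ) : ℝ :=
  (-1 + q ^ 2) + (-2 * q ^ 6 + 3 * q ^ 4 - 5 * q ^ 2 + 2) * cn t q ^ 2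
    + (2 * q ^ 2 * (q ^ 4 - q ^ 2 + 1)) * cn t q ^ 4
    + ((-q ^ 4 + 3 * q ^ 2 - 2) * t + (2 * (q ^ 4 - q ^ 2 + 1)) * jacobiEpsilon t q) * u₁ t q

/-- `w₁(t) = κ u₁(√((a - c) / 6) t + i_y, q)`, with a normalizing constant `κ`. -/
def w₁ (a c y κ t : ℝ) : ℝ := κ * u₁ (phaseTime a c y t) (modulus a c)

/-- `w₂(t) = κ u₂(√((a - c) / 6) t + i_y, q)`, with a normalizing constant `κ`. -/
def w₂ (a c y κ t : ℝ) : ℝ := κ * u₂ (phaseTime a c y t) (modulus a c)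

/-- `w` is a (twice differentiable) solution of `w'' = 2 f w` on `ℝ`. -/
def SolvesHomogeneous (f w : ℝ → ℝ) : Prop :=
  ∀ t, DifferentiableAt ℝ w t ∧ HasDerivAt (deriv w) (2 * f t * w t) t

/-- The Wronskian `v w' - v' w`. -/
def wronskian (v w : ℝ → ℝ) (t : ℝ) : ℝ := v t * deriv w t - deriv v t * w t

/-- The kernel `𝒦(t, s) = w₂(t) w₁(s) - w₁(t) w₂(s)`. -/
def kernelK (v w : ℝ → ℝ) (t s : ℝ) : ℝ := w t * v s - v t * w s

/-! ### Brownian filtration, strong solutions, Wiener integral -/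

section Stochastic

variable {Ω : Type*} [mΩ : MeasurableSpace Ω]

/-- The (augmented) Brownian filtration: at time `t`, the σ-algebra generated by
`B s` for `s ≤ t` and by the `P`-null sets. -/
def brownianFiltration {B : ℝ≥0 → Ω → ℝ} {P : Measure Ω} [P.IsComplete]
    (hB : IsBrownianReal B P) : Filtration ℝ≥0 mΩ where
  seq t := (⨆ s ≤ t, MeasurableSpace.comap (B s) (borel ℝ)) ⊔
    MeasurableSpace.generateFrom {N : Set Ω | P N = 0}
  mono' _ _ hst :=
    sup_le_sup_right (biSup_mono fun _ hr => hr.trans hst) _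
  le' t := by
    refine sup_le (iSup₂_le fun s _ => ?_) (MeasurableSpace.generateFrom_le fun N hN => ?_)
    · have h : Measurable (B s) := (hB.aemeasurable s).nullMeasurable.measurable_of_complete
      rw [← BorelSpace.measurable_eq (α := ℝ)]
      exact h.comap_le
    · exact Measure.IsComplete.out' N hN

/-- `(x, ξ)` is a global strong solution, relative to the filtration `𝓕` and the driving
process `B`, of the system
`dx = ξ dt`, `dξ = 2 f(t) x dt + dB(t)`, `x(0) = 0`, `ξ(0) = 0`, `t ∈ [0, ∞)`. -/
structure IsStrongSolution (f : ℝ → ℝ) (B : ℝ≥0 → Ω → ℝ) (P : Measure Ω)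
    (𝓕 : Filtration ℝ≥0 mΩ) (x ξ : ℝ≥0 → Ω → ℝ) : Prop where
  adapted_x : Adapted 𝓕 x
  adapted_ξ : Adapted 𝓕 ξ
  continuous_x : ∀ᵐ ω ∂P, Continuous fun t => x t ω
  continuous_ξ : ∀ᵐ ω ∂P, Continuous fun t => ξ t ω
  init_x : ∀ᵐ ω ∂P, x 0 ω = 0
  init_ξ : ∀ᵐ ω ∂P, ξ 0 ω = 0
  eq_x : ∀ᵐ ω ∂P, ∀ t : ℝ≥0, x t ω = ∫ s in (0 : ℝ)..t, ξ s.toNNReal ω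
  eq_ξ : ∀ᵐ ω ∂P, ∀ t : ℝ≥0,
    ξ t ω = (∫ s in (0 : ℝ)..t, 2 * f s * x s.toNNReal ω) + (B t ω - B 0 ω)

/-- A deterministic step function `∑_{i < n} c i • 1_{(τ i, τ (i + 1)]}` on `[0, t]`. -/
structure StepFunction (t : ℝ≥0) where
  n : ℕ
  τ : ℕ → ℝ≥0
  mono : Monotone τ
  le : ∀ i, τ i ≤ t
  c : ℕ → ℝ

/-- The function on `ℝ` represented by a step function. -/
def StepFunction.toFun {t : ℝ≥0} (φ : StepFunction t) (s : ℝ) : ℝ :=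
  ∑ i ∈ Finset.range φ.n,
    Set.indicator (Set.Ioc (φ.τ i : ℝ) (φ.τ (i + 1) : ℝ)) (fun _ => φ.c i) s

/-- The elementary integral `∑_{i < n} c i * (B (τ (i + 1)) - B (τ i))`. -/
def StepFunction.integral {t : ℝ≥0} (φ : StepFunction t) (B : ℝ≥0 → Ω → ℝ) (ω : Ω) : ℝ :=
  ∑ i ∈ Finset.range φ.n, φ.c i * (B (φ.τ (i + 1)) ω - B (φ.τ i) ω)

/-- `X` is (a version of) the Wiener integral `∫₀ᵗ g(s) dB(s)` of `g ∈ L²([0, t])`: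
the `L²(P)`-limit of the elementary integrals of step functions that converge to `g` in
`L²([0, t])`. For a Brownian motion `B`, the Itô isometry makes the limit exist for every
`g ∈ L²([0, t])`, independently of the sequence, and determines `X` almost surely. -/
def HasWienerIntegral (B : ℝ≥0 → Ω → ℝ) (P : Measure Ω) (t : ℝ≥0) (g : ℝ → ℝ)
    (X : Ω → ℝ) : Prop :=
  MemLp g 2 (volume.restrict (Set.Icc (0 : ℝ) t)) ∧ MemLp X 2 P ∧
  ∃ φ : ℕ → StepFunction t,
    Tendsto (fun n => eLpNorm (fun s => (φ n).toFun s - g s) 2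
      (volume.restrict (Set.Icc (0 : ℝ) t))) atTop (𝓝 0) ∧
    Tendsto (fun n => eLpNorm (fun ω => (φ n).integral B ω - X ω) 2 P) atTop (𝓝 0)

end Stochastic

end StochasticLame

end

open StochasticLame

namespace StochasticLame

/-! ### Derivatives of the Jacobi elliptic functions -/

/-! The noise is additive, so everything can be done path by path. Given two solutions v, w of the
homogeneous equation with Wronskian 1, variation of constants followed by integration by parts gives
a formula that needs only continuity of the forcing path, not its derivative (`variationPosition`).
Applied to Brownian paths it yields existence. Uniqueness is deterministic too: a difference of two
solutions has zero Wronskian against both v and w, hence vanishes (`eq_zero_of_eq_integral`).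

The explicit v, w come from the derivative formulas for sn, cn, dn, which reduce the Lamé equation
and the Wronskian to polynomial identities in cn.

Probability enters in identifying the integrated-by-parts expression with a Wiener integral: for a
C¹ integrand, left-endpoint sums on uniform grids converge to it in L²
(`tendsto_eLpNorm_integral_gridStep`). Adaptedness then follows along an almost surely convergent
subsequence, and Gaussianity because L² limits of Gaussian processes are Gaussian
(`IsGaussianProcess.of_tendsto_eLpNorm_two`). -/

lemma one_sub_modulus_sin_pos {q : ℝ} (hq : q ^ 2 < 1) (γ : ℝ) :
    0 < 1 - q ^ 2 * Real.sin γ ^ 2 := by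
  nlinarith [Real.sin_sq_le_one γ, sq_nonneg q, sq_nonneg (Real.sin γ)]

lemma continuous_ellipticF_integrand {q : ℝ} (hq : q ^ 2 < 1) :
    Continuous fun α : ℝ => 1 / √(1 - q ^ 2 * Real.sin α ^ 2) :=
  continuous_const.div (by fun_prop) fun α => (Real.sqrt_pos.2 (one_sub_modulus_sin_pos hq α)).ne'

lemma hasDerivAt_ellipticF {q : ℝ} (hq : q ^ 2 < 1) (γ : ℝ) :
    HasDerivAt (fun γ => ellipticF γ q) (1 / √(1 - q ^ 2 * Real.sin γ ^ 2)) γ :=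
  (continuous_ellipticF_integrand hq).integral_hasStrictDerivAt 0 γ |>.hasDerivAt

lemma strictMono_ellipticF {q : ℝ} (hq : q ^ 2 < 1) : StrictMono fun γ => ellipticF γ q :=
  strictMono_of_hasDerivAt_pos (hasDerivAt_ellipticF hq) fun γ =>
    one_div_pos.2 (Real.sqrt_pos.2 (one_sub_modulus_sin_pos hq γ))

/-- The integrand is at least 1. The resulting comparison with the identity gives the limits at ±∞
needed for surjectivity. -/
lemma ellipticF_sub_self_monotone {q : ℝ} (hq : q ^ 2 < 1) :
    Monotone fun γ => ellipticF γ q - γ := by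
  refine monotone_of_hasDerivAt_nonneg
    (fun γ => (hasDerivAt_ellipticF hq γ).sub (hasDerivAt_id γ)) fun γ => ?_
  have h0 := one_sub_modulus_sin_pos hq γ
  have h1 : √(1 - q ^ 2 * Real.sin γ ^ 2) ≤ 1 := by
    refine Real.sqrt_le_one.2 ?_
    nlinarith [mul_nonneg (sq_nonneg q) (sq_nonneg (Real.sin γ))]
  have := one_le_one_div (Real.sqrt_pos.2 h0) h1
  simpa using this

lemma surjective_ellipticF {q : ℝ} (hq : q ^ 2 < 1) :
    Function.Surjective fun γ => ellipticF γ q := by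
  have h0 : ellipticF 0 q = 0 := by simp [ellipticF]
  have hm := ellipticF_sub_self_monotone hq
  refine (continuous_iff_continuousAt.2 fun γ =>
    (hasDerivAt_ellipticF hq γ).continuousAt).surjective ?_ ?_
  · refine tendsto_atTop_mono' _ ?_ tendsto_id
    filter_upwards [eventually_ge_atTop 0] with γ hγ
    have := hm hγ
    simp only [h0] at this
    simp only [id]
    linarith
  · refine tendsto_atBot_mono' _ ?_ tendsto_id
    filter_upwards [eventually_le_atBot 0] with γ hγ
    have := hm hγ
    simp only [h0] at this
    simp only [id]
    linarith

lemma ellipticF_am {q : ℝ} (hq : q ^ 2 < 1) (u : ℝ) : ellipticF (am u q) q = u :=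
  Function.rightInverse_invFun (surjective_ellipticF hq) u

/-- A monotone surjection of ℝ has no jumps. Continuity is required before the inverse can be
differentiated. -/
lemma continuous_am {q : ℝ} (hq : q ^ 2 < 1) : Continuous fun u => am u q := by
  refine Monotone.continuous_of_surjective (fun u v huv => ?_) fun γ => ?_
  · rw [← (strictMono_ellipticF hq).le_iff_le]
    simpa only [ellipticF_am hq] using huv
  · exact ⟨ellipticF γ q, (strictMono_ellipticF hq).injective (ellipticF_am hq _)⟩

lemma hasDerivAt_am {q : ℝ} (hq : q ^ 2 < 1) (u : ℝ) :
    HasDerivAt (fun u => am u q) (dn u q) u := by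
  have h := HasDerivAt.of_local_left_inverse (f := fun γ => ellipticF γ q)
    (continuous_am hq).continuousAt (hasDerivAt_ellipticF hq (am u q))
    (one_div_pos.2 (Real.sqrt_pos.2 (one_sub_modulus_sin_pos hq _))).ne'
    (Eventually.of_forall (ellipticF_am hq))
  simpa [dn, sn] using h

lemma hasDerivAt_sn {q : ℝ} (hq : q ^ 2 < 1) (u : ℝ) :
    HasDerivAt (fun u => sn u q) (cn u q * dn u q) u :=
  (hasDerivAt_am hq u).sin

lemma hasDerivAt_cn {q : ℝ} (hq : q ^ 2 < 1) (u : ℝ) :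
    HasDerivAt (fun u => cn u q) (-(sn u q * dn u q)) u :=
  (hasDerivAt_am hq u).cos.congr_deriv (neg_mul _ _)

lemma dn_pos {q : ℝ} (hq : q ^ 2 < 1) (u : ℝ) : 0 < dn u q :=
  Real.sqrt_pos.2 (one_sub_modulus_sin_pos hq _)

lemma sn_sq (u q : ℝ) : sn u q ^ 2 = 1 - cn u q ^ 2 := Real.sin_sq _

lemma dn_sq {q : ℝ} (hq : q ^ 2 < 1) (u : ℝ) : dn u q ^ 2 = 1 - q ^ 2 + q ^ 2 * cn u q ^ 2 := by
  rw [dn, Real.sq_sqrt (x := 1 - q ^ 2 * sn u q ^ 2) (one_sub_modulus_sin_pos hq (am u q)).le, sn_sq]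
  ring

lemma hasDerivAt_dn {q : ℝ} (hq : q ^ 2 < 1) (u : ℝ) :
    HasDerivAt (fun u => dn u q) (-(q ^ 2 * sn u q * cn u q)) u := by
  have h := ((((hasDerivAt_sn hq u).pow 2).const_mul (q ^ 2)).const_sub 1).sqrt
    (one_sub_modulus_sin_pos hq _).ne'
  refine h.congr_deriv ?_
  have := (dn_pos hq u).ne'
  change _ / (2 * dn u q) = _
  field_simp
  ring

lemma hasDerivAt_jacobiEpsilon {q : ℝ} (hq : q ^ 2 < 1) (u : ℝ) :
    HasDerivAt (fun u => jacobiEpsilon u q) (dn u q ^ 2) u := by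
  have hc : Continuous fun t => dn t q ^ 2 := continuous_iff_continuousAt.2 fun t =>
    ((hasDerivAt_dn hq t).pow 2).continuousAt
  exact (hc.integral_hasStrictDerivAt 0 u).hasDerivAt

/-! ### The two Lamé functions -/

/-- The derivative of `u₁`, as a polynomial in `cn`. -/
noncomputable def derivU₁ (t q : ℝ) : ℝ :=
  -(1 - q ^ 2) + (2 - 4 * q ^ 2) * cn t q ^ 2 + 3 * q ^ 2 * cn t q ^ 4

/-- The potential of the Lamé equation solved by `u₁` and `u₂`. -/
noncomputable def lamePotential (t q : ℝ) : ℝ := -4 * (1 + q ^ 2) + 12 * q ^ 2 * sn t q ^ 2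

/-- The derivative of `u₂`. -/
noncomputable def derivU₂ (t q : ℝ) : ℝ :=
  u₁ t q * (((-q ^ 4 + 3 * q ^ 2 - 2) - 2 * (-2 * q ^ 6 + 3 * q ^ 4 - 5 * q ^ 2 + 2)
      + 2 * (q ^ 4 - q ^ 2 + 1) * (1 - q ^ 2)) - 6 * q ^ 2 * (q ^ 4 - q ^ 2 + 1) * cn t q ^ 2)
    + ((-q ^ 4 + 3 * q ^ 2 - 2) * t + (2 * (q ^ 4 - q ^ 2 + 1)) * jacobiEpsilon t q) * derivU₁ t q

lemma u₁_sq {q : ℝ} (hq : q ^ 2 < 1) (t : ℝ) :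
    u₁ t q ^ 2 = (1 - cn t q ^ 2) * cn t q ^ 2 * (1 - q ^ 2 + q ^ 2 * cn t q ^ 2) := by
  rw [u₁, mul_pow, mul_pow, sn_sq, dn_sq hq]

lemma hasDerivAt_u₁ {q : ℝ} (hq : q ^ 2 < 1) (t : ℝ) :
    HasDerivAt (fun t => u₁ t q) (derivU₁ t q) t := by
  refine (((hasDerivAt_sn hq t).mul (hasDerivAt_cn hq t)).mul
    (hasDerivAt_dn hq t)).congr_deriv ?_
  have hS := sn_sq t q
  have hD := dn_sq hq t
  simp only [derivU₁, Pi.mul_apply]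
  linear_combination (-dn t q ^ 2 - q ^ 2 * cn t q ^ 2) * hS + (2 * cn t q ^ 2 - 1) * hD

lemma hasDerivAt_derivU₁ {q : ℝ} (hq : q ^ 2 < 1) (t : ℝ) :
    HasDerivAt (fun t => derivU₁ t q) (lamePotential t q * u₁ t q) t := by
  have hC := hasDerivAt_cn hq t
  refine ((((hC.pow 2).const_mul (2 - 4 * q ^ 2)).const_add (-(1 - q ^ 2))).add
    ((hC.pow 4).const_mul (3 * q ^ 2))).congr_deriv ?_
  simp only [lamePotential, u₁, sn_sq]
  push_cast
  ring

lemma hasDerivAt_u₂ {q : ℝ} (hq : q ^ 2 < 1) (t : ℝ) :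
    HasDerivAt (fun t => u₂ t q) (derivU₂ t q) t := by
  have hC := hasDerivAt_cn hq t
  refine (((((hC.pow 2).const_mul (-2 * q ^ 6 + 3 * q ^ 4 - 5 * q ^ 2 + 2)).const_add
    (-1 + q ^ 2)).add ((hC.pow 4).const_mul (2 * q ^ 2 * (q ^ 4 - q ^ 2 + 1)))).add
    ((((hasDerivAt_id t).const_mul (-q ^ 4 + 3 * q ^ 2 - 2)).add
      ((hasDerivAt_jacobiEpsilon hq t).const_mul (2 * (q ^ 4 - q ^ 2 + 1)))).mul
      (hasDerivAt_u₁ hq t))).congr_deriv ?_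
  simp only [derivU₂, u₁, dn_sq hq, id, Pi.add_apply]
  push_cast
  ring

lemma hasDerivAt_derivU₂ {q : ℝ} (hq : q ^ 2 < 1) (t : ℝ) :
    HasDerivAt (fun t => derivU₂ t q) (lamePotential t q * u₂ t q) t := by
  have hC := hasDerivAt_cn hq t
  refine (((hasDerivAt_u₁ hq t).mul (((hC.pow 2).const_mul
      (6 * q ^ 2 * (q ^ 4 - q ^ 2 + 1))).const_sub
      ((-q ^ 4 + 3 * q ^ 2 - 2) - 2 * (-2 * q ^ 6 + 3 * q ^ 4 - 5 * q ^ 2 + 2)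
      + 2 * (q ^ 4 - q ^ 2 + 1) * (1 - q ^ 2)))).add
    ((((hasDerivAt_id t).const_mul (-q ^ 4 + 3 * q ^ 2 - 2)).add
      ((hasDerivAt_jacobiEpsilon hq t).const_mul (2 * (q ^ 4 - q ^ 2 + 1)))).mul
      (hasDerivAt_derivU₁ hq t))).congr_deriv ?_
  have h1 := u₁_sq hq t
  -- Differentiating cn² produces the product sn·cn·dn next to a factor `u₁`. Folding both into u₁²
  -- leaves only even powers of cn, besides the multiple of `u₁` carrying t and ℰ.
  have h2 : sn t q * cn t q * dn t q = u₁ t q := rfl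
  simp only [derivU₁, u₂, lamePotential, dn_sq hq, sn_sq, id, Pi.add_apply, Pi.pow_apply]
  push_cast
  linear_combination (12 * q ^ 2 * (q ^ 4 - q ^ 2 + 1)) * h1
    + (12 * q ^ 2 * (q ^ 4 - q ^ 2 + 1)) * u₁ t q * h2

/-- The terms containing t and ℰ multiply `u₁` times its derivative in both products and cancel; u₁²
turns the rest into a polynomial in cn whose non-constant coefficients vanish. -/
lemma u₁_mul_derivU₂_sub {q : ℝ} (hq : q ^ 2 < 1) (t : ℝ) :
    u₁ t q * derivU₂ t q - derivU₁ t q * u₂ t q = -(1 - q ^ 2) ^ 2 := by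
  have h1 := u₁_sq hq t
  simp only [derivU₁, u₂, derivU₂]
  linear_combination (((-q ^ 4 + 3 * q ^ 2 - 2) - 2 * (-2 * q ^ 6 + 3 * q ^ 4 - 5 * q ^ 2 + 2)
      + 2 * (q ^ 4 - q ^ 2 + 1) * (1 - q ^ 2)) - 6 * q ^ 2 * (q ^ 4 - q ^ 2 + 1) * cn t q ^ 2) * h1

/-! ### The Lamé solutions in the time variable of `x₀` -/

lemma modulus_sq {a c : ℝ} (hcb : c < -a - c) (hca : c < a) :
    modulus a c ^ 2 = (2 * c + a) / (c - a) :=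
  Real.sq_sqrt (div_nonneg_of_nonpos (by linarith) (by linarith))

lemma modulus_sq_lt_one {a c : ℝ} (hcb : c < -a - c) (hba : -a - c < a) :
    modulus a c ^ 2 < 1 := by
  rw [modulus_sq hcb (hcb.trans hba), div_lt_one_of_neg (by linarith)]
  linarith

lemma hasDerivAt_comp_phaseTime {u : ℝ → ℝ} {u' : ℝ} (a c y κ : ℝ) {t : ℝ}
    (h : HasDerivAt u u' (phaseTime a c y t)) :
    HasDerivAt (fun t => κ * u (phaseTime a c y t)) (κ * √((a - c) / 6) * u') t := by
  have h1 : HasDerivAt (phaseTime a c y) (√((a - c) / 6)) t := by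
    exact (((hasDerivAt_id t).const_mul (√((a - c) / 6))).add_const (phase a c y)).congr_deriv
      (mul_one _)
  exact ((h.comp t h1).const_mul κ).congr_deriv (by ring)

/-- With q² = (2c + a)/(c - a) one has 1 + q² = 3c/(c - a), so the rescaling by (a - c)/6 turns the
two terms into 2c and -2(a + 2c) sn². -/
lemma lamePotential_phaseTime {a c : ℝ} (hcb : c < -a - c) (hba : -a - c < a) (y t : ℝ) :
    √((a - c) / 6) ^ 2 * lamePotential (phaseTime a c y t) (modulus a c) = 2 * x₀ a c y t := by
  have hca := hcb.trans hba
  have : c - a ≠ 0 := by linarith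
  rw [Real.sq_sqrt (by linarith), lamePotential, x₀, modulus_sq hcb hca]
  field_simp
  ring

lemma solvesHomogeneous_comp_phaseTime {u u' : ℝ → ℝ} {a c : ℝ} (hcb : c < -a - c)
    (hba : -a - c < a) (y κ : ℝ) (h : ∀ t, HasDerivAt u (u' t) t)
    (h' : ∀ t, HasDerivAt u' (lamePotential t (modulus a c) * u t) t) :
    SolvesHomogeneous (x₀ a c y) (fun t => κ * u (phaseTime a c y t)) := by
  have hd : deriv (fun t => κ * u (phaseTime a c y t)) =
      fun t => κ * √((a - c) / 6) * u' (phaseTime a c y t) :=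
    funext fun t => (hasDerivAt_comp_phaseTime a c y κ (h _)).deriv
  refine fun t => ⟨(hasDerivAt_comp_phaseTime a c y κ (h _)).differentiableAt, ?_⟩
  rw [hd]
  refine (hasDerivAt_comp_phaseTime a c y _ (h' _)).congr_deriv ?_
  linear_combination (κ * u (phaseTime a c y t)) * lamePotential_phaseTime hcb hba y t

lemma solvesHomogeneous_w₁ {a c : ℝ} (hcb : c < -a - c) (hba : -a - c < a) (y κ : ℝ) :
    SolvesHomogeneous (x₀ a c y) (w₁ a c y κ) :=
  have hq := modulus_sq_lt_one hcb hba
  solvesHomogeneous_comp_phaseTime hcb hba y κ (hasDerivAt_u₁ hq) (hasDerivAt_derivU₁ hq)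

lemma solvesHomogeneous_w₂ {a c : ℝ} (hcb : c < -a - c) (hba : -a - c < a) (y κ : ℝ) :
    SolvesHomogeneous (x₀ a c y) (w₂ a c y κ) :=
  have hq := modulus_sq_lt_one hcb hba
  solvesHomogeneous_comp_phaseTime hcb hba y κ (hasDerivAt_u₂ hq) (hasDerivAt_derivU₂ hq)

lemma wronskian_w₁_w₂ {a c : ℝ} (hcb : c < -a - c) (hba : -a - c < a) (y κ₁ κ₂ t : ℝ) :
    wronskian (w₁ a c y κ₁) (w₂ a c y κ₂) t =
      κ₁ * κ₂ * (-(√((a - c) / 6) * (1 - modulus a c ^ 2) ^ 2)) := by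
  have hq := modulus_sq_lt_one hcb hba
  have h1 : deriv (w₁ a c y κ₁) t = _ :=
    (hasDerivAt_comp_phaseTime a c y κ₁ (hasDerivAt_u₁ hq _)).deriv
  have h2 : deriv (w₂ a c y κ₂) t = _ :=
    (hasDerivAt_comp_phaseTime a c y κ₂ (hasDerivAt_u₂ hq _)).deriv
  rw [wronskian, h1, h2, w₁, w₂]
  linear_combination (κ₁ * κ₂ * √((a - c) / 6)) *
    u₁_mul_derivU₂_sub hq (phaseTime a c y t)

lemma continuous_x₀ {a c : ℝ} (hcb : c < -a - c) (hba : -a - c < a) (y : ℝ) :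
    Continuous (x₀ a c y) := by
  have hs : Continuous fun u => sn u (modulus a c) := continuous_iff_continuousAt.2 fun t =>
    (hasDerivAt_sn (modulus_sq_lt_one hcb hba) t).continuousAt
  unfold x₀ phaseTime
  fun_prop

/-! ### Variation of constants for `x'' = 2 f x + b'` -/

lemma SolvesHomogeneous.hasDerivAt {f u : ℝ → ℝ} (h : SolvesHomogeneous f u) (t : ℝ) :
    HasDerivAt u (deriv u t) t :=
  (h t).1.hasDerivAt

lemma SolvesHomogeneous.continuous_deriv {f u : ℝ → ℝ} (h : SolvesHomogeneous f u) :
    Continuous (deriv u) :=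
  continuous_iff_continuousAt.2 fun t => (h t).2.continuousAt

lemma SolvesHomogeneous.hasDerivAt_integral_deriv_mul {f u b : ℝ → ℝ} (h : SolvesHomogeneous f u)
    (hb : Continuous b) (t : ℝ) :
    HasDerivAt (fun t => ∫ s in (0 : ℝ)..t, deriv u s * b s) (deriv u t * b t) t :=
  ((h.continuous_deriv.mul hb).integral_hasStrictDerivAt 0 t).hasDerivAt

/-- The solution of `x'' = 2 f x + b'` with zero initial data, integrated by parts so that it
makes sense for a forcing path `b` that is merely continuous. -/
noncomputable def variationPosition (v w b : ℝ → ℝ) (t : ℝ) : ℝ :=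
  v t * (∫ s in (0 : ℝ)..t, deriv w s * b s) - w t * ∫ s in (0 : ℝ)..t, deriv v s * b s

/-- The velocity of `variationPosition`. -/
noncomputable def variationVelocity (v w b : ℝ → ℝ) (t : ℝ) : ℝ :=
  (deriv v t * (∫ s in (0 : ℝ)..t, deriv w s * b s) -
    deriv w t * ∫ s in (0 : ℝ)..t, deriv v s * b s) + b t

section Variation

variable {f v w b : ℝ → ℝ}

lemma hasDerivAt_variationPosition (hv : SolvesHomogeneous f v) (hw : SolvesHomogeneous f w)
    (hvw : ∀ t, wronskian v w t = 1) (hb : Continuous b) (t : ℝ) :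
    HasDerivAt (variationPosition v w b) (variationVelocity v w b t) t := by
  have h1 := (hv.hasDerivAt_integral_deriv_mul hb t)
  have h2 := (hw.hasDerivAt_integral_deriv_mul hb t)
  refine (((hv.hasDerivAt t).mul h2).sub ((hw.hasDerivAt t).mul h1)).congr_deriv ?_
  have := hvw t
  simp only [wronskian] at this
  simp only [variationVelocity]
  linear_combination b t * this

/-- The path b need not be differentiable, so only the velocity minus b is differentiated; the two
terms v'w'b cancel. -/
lemma hasDerivAt_variationVelocity_sub (hv : SolvesHomogeneous f v) (hw : SolvesHomogeneous f w)
    (hb : Continuous b) (t : ℝ) :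
    HasDerivAt (fun t => variationVelocity v w b t - b t)
      (2 * f t * variationPosition v w b t) t := by
  have h1 := (hv.hasDerivAt_integral_deriv_mul hb t)
  have h2 := (hw.hasDerivAt_integral_deriv_mul hb t)
  simp only [variationVelocity, add_sub_cancel_right]
  refine (((hv t).2.mul h2).sub ((hw t).2.mul h1)).congr_deriv ?_
  simp only [variationPosition]
  ring

lemma continuous_variationPosition (hv : SolvesHomogeneous f v) (hw : SolvesHomogeneous f w)
    (hvw : ∀ t, wronskian v w t = 1) (hb : Continuous b) :
    Continuous (variationPosition v w b) :=
  continuous_iff_continuousAt.2 fun t =>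
    (hasDerivAt_variationPosition hv hw hvw hb t).continuousAt

lemma continuous_variationVelocity (hv : SolvesHomogeneous f v) (hw : SolvesHomogeneous f w)
    (hb : Continuous b) : Continuous (variationVelocity v w b) := by
  have h : Continuous fun t => variationVelocity v w b t - b t :=
    continuous_iff_continuousAt.2 fun t =>
      (hasDerivAt_variationVelocity_sub hv hw hb t).continuousAt
  exact (h.add hb).congr fun t => sub_add_cancel _ _

lemma variationPosition_eq_integral (hv : SolvesHomogeneous f v) (hw : SolvesHomogeneous f w)
    (hvw : ∀ t, wronskian v w t = 1) (hb : Continuous b) (t : ℝ) :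
    variationPosition v w b t = ∫ s in (0 : ℝ)..t, variationVelocity v w b s := by
  rw [intervalIntegral.integral_eq_sub_of_hasDerivAt
    (fun s _ => hasDerivAt_variationPosition hv hw hvw hb s)
    ((continuous_variationVelocity hv hw hb).intervalIntegrable _ _)]
  simp [variationPosition]

lemma variationVelocity_eq_integral (hf : Continuous f) (hv : SolvesHomogeneous f v)
    (hw : SolvesHomogeneous f w) (hvw : ∀ t, wronskian v w t = 1) (hb : Continuous b) (t : ℝ) :
    variationVelocity v w b t =
      (∫ s in (0 : ℝ)..t, 2 * f s * variationPosition v w b s) + b t := by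
  rw [intervalIntegral.integral_eq_sub_of_hasDerivAt
    (fun s _ => hasDerivAt_variationVelocity_sub hv hw hb s)
    (((continuous_const.mul hf).mul
      (continuous_variationPosition hv hw hvw hb)).intervalIntegrable _ _)]
  simp [variationVelocity]

/-- A solution with zero initial data has vanishing Wronskian against any other solution. -/
lemma SolvesHomogeneous.mul_sub_deriv_mul_eq_zero {u x ξ : ℝ → ℝ} (hu : SolvesHomogeneous f u)
    (hf : Continuous f) (hx : Continuous x) (hξ : Continuous ξ)
    (ex : ∀ t, 0 ≤ t → x t = ∫ s in (0 : ℝ)..t, ξ s)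
    (eξ : ∀ t, 0 ≤ t → ξ t = ∫ s in (0 : ℝ)..t, 2 * f s * x s) {t : ℝ} (ht : 0 ≤ t) :
    u t * ξ t - deriv u t * x t = 0 := by
  -- The integral equations hold only for nonnegative times. The primitives are differentiable on
  -- all of ℝ and agree with x and ξ where needed.
  let X : ℝ → ℝ := fun t => ∫ s in (0 : ℝ)..t, ξ s
  let Ξ : ℝ → ℝ := fun t => ∫ s in (0 : ℝ)..t, 2 * f s * x s
  have hX : ∀ t, HasDerivAt X (ξ t) t := fun t =>
    (hξ.integral_hasStrictDerivAt 0 t).hasDerivAt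
  have hΞ : ∀ t, HasDerivAt Ξ (2 * f t * x t) t := fun t =>
    (((continuous_const.mul hf).mul hx).integral_hasStrictDerivAt 0 t).hasDerivAt
  have hF : ∀ t, HasDerivAt (fun t => u t * Ξ t - deriv u t * X t) _ t := fun t =>
    ((hu.hasDerivAt t).mul (hΞ t)).sub ((hu t).2.mul (hX t))
  have h0 := constant_of_has_deriv_right_zero
    (f := fun t => u t * Ξ t - deriv u t * X t) (a := 0) (b := t)
    (fun s _ => (hF s).continuousAt.continuousWithinAt) (fun s hs => by
      refine ((hF s).congr_deriv ?_).hasDerivWithinAt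
      have e1 : X s = x s := (ex s hs.1).symm
      have e2 : Ξ s = ξ s := (eξ s hs.1).symm
      rw [e1, e2]
      ring) t ⟨ht, le_rfl⟩
  rw [ex t ht, eξ t ht]
  simpa [X, Ξ] using h0

/-- The two vanishing Wronskians form a linear system for (x, ξ) whose determinant is, up to sign,
the Wronskian of v and w; Cramer's rule replaces a Gronwall estimate. -/
lemma eq_zero_of_eq_integral {x ξ : ℝ → ℝ} (hv : SolvesHomogeneous f v)
    (hw : SolvesHomogeneous f w) (hvw : ∀ t, wronskian v w t = 1)
    (hf : Continuous f) (hx : Continuous x) (hξ : Continuous ξ)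
    (ex : ∀ t, 0 ≤ t → x t = ∫ s in (0 : ℝ)..t, ξ s)
    (eξ : ∀ t, 0 ≤ t → ξ t = ∫ s in (0 : ℝ)..t, 2 * f s * x s) {t : ℝ} (ht : 0 ≤ t) :
    x t = 0 ∧ ξ t = 0 := by
  have h1 := hv.mul_sub_deriv_mul_eq_zero hf hx hξ ex eξ ht
  have h2 := hw.mul_sub_deriv_mul_eq_zero hf hx hξ ex eξ ht
  have h3 := hvw t
  simp only [wronskian] at h3
  constructor
  · linear_combination w t * h1 - v t * h2 - x t * h3
  · linear_combination deriv w t * h1 - deriv v t * h2 - ξ t * h3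

lemma eq_of_eq_integral_add {x ξ x' ξ' : ℝ → ℝ} (hv : SolvesHomogeneous f v)
    (hw : SolvesHomogeneous f w) (hvw : ∀ t, wronskian v w t = 1) (hf : Continuous f)
    (hx : Continuous x) (hξ : Continuous ξ) (hx' : Continuous x') (hξ' : Continuous ξ')
    (ex : ∀ t, 0 ≤ t → x t = ∫ s in (0 : ℝ)..t, ξ s)
    (eξ : ∀ t, 0 ≤ t → ξ t = (∫ s in (0 : ℝ)..t, 2 * f s * x s) + b t)
    (ex' : ∀ t, 0 ≤ t → x' t = ∫ s in (0 : ℝ)..t, ξ' s)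
    (eξ' : ∀ t, 0 ≤ t → ξ' t = (∫ s in (0 : ℝ)..t, 2 * f s * x' s) + b t)
    {t : ℝ} (ht : 0 ≤ t) : x' t = x t ∧ ξ' t = ξ t := by
  have h := eq_zero_of_eq_integral (x := fun t => x' t - x t) (ξ := fun t => ξ' t - ξ t)
    hv hw hvw hf (hx'.sub hx) (hξ'.sub hξ) (fun t ht => ?_) (fun t ht => ?_) ht
  · exact ⟨sub_eq_zero.1 h.1, sub_eq_zero.1 h.2⟩
  · rw [ex t ht, ex' t ht, intervalIntegral.integral_sub
      (hξ'.intervalIntegrable _ _) (hξ.intervalIntegrable _ _)]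
  · have h1 : Continuous fun s => 2 * f s * x s := by fun_prop
    have h2 : Continuous fun s => 2 * f s * x' s := by fun_prop
    simp only [mul_sub]
    rw [eξ t ht, eξ' t ht, intervalIntegral.integral_sub
      (h2.intervalIntegrable _ _) (h1.intervalIntegrable _ _)]
    ring

end Variation

/-! ### Limits of Gaussian variables in `L²` -/

section Gaussian

variable {Ω : Type*} [MeasurableSpace Ω] {P : Measure Ω}

lemma tendsto_integral_of_tendsto_eLpNorm_two [IsProbabilityMeasure P] {X : ℕ → Ω → ℝ}
    {Y : Ω → ℝ} (hX : ∀ n, MemLp (X n) 2 P) (hY : MemLp Y 2 P)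
    (h : Tendsto (fun n => eLpNorm (X n - Y) 2 P) atTop (𝓝 0)) :
    Tendsto (fun n => ∫ ω, X n ω ∂P) atTop (𝓝 (∫ ω, Y ω ∂P)) := by
  refine tendsto_integral_of_L1' Y hY.aestronglyMeasurable
    (Eventually.of_forall fun n => (hX n).integrable one_le_two) ?_
  refine tendsto_of_tendsto_of_tendsto_of_le_of_le tendsto_const_nhds h (fun _ => zero_le)
    fun n => ?_
  exact eLpNorm_le_eLpNorm_of_exponent_le one_le_two
    ((hX n).aestronglyMeasurable.sub hY.aestronglyMeasurable)

lemma tendsto_variance_of_tendsto_eLpNorm_two [IsProbabilityMeasure P] {X : ℕ → Ω → ℝ}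
    {Y : Ω → ℝ} (hX : ∀ n, MemLp (X n) 2 P) (hY : MemLp Y 2 P)
    (h : Tendsto (fun n => eLpNorm (X n - Y) 2 P) atTop (𝓝 0)) :
    Tendsto (fun n => Var[X n; P]) atTop (𝓝 Var[Y; P]) := by
  -- Second moments are squared norms in L², so they converge by continuity of the norm.
  have hsq : ∀ {Z : Ω → ℝ} (hZ : MemLp Z 2 P), ∫ ω, (Z ^ 2) ω ∂P = ‖hZ.toLp Z‖ ^ 2 := by
    intro Z hZ
    rw [← real_inner_self_eq_norm_sq, L2.inner_def]
    refine integral_congr_ae ?_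
    filter_upwards [hZ.coeFn_toLp] with ω hω
    simp [hω]
  have h2 := (Lp.tendsto_Lp_iff_tendsto_eLpNorm'' X hX Y hY).2 h
  have h1 := tendsto_integral_of_tendsto_eLpNorm_two hX hY h
  rw [variance_eq_sub hY, hsq hY]
  simp_rw [fun n => variance_eq_sub (hX n), fun n => hsq (hX n)]
  exact (h2.norm.pow 2).sub (h1.pow 2)

/-- A Gaussian characteristic function depends continuously on mean and variance, both of which
converge. A degenerate limit needs no separate treatment. -/
lemma HasGaussianLaw.of_tendsto_eLpNorm_two [IsProbabilityMeasure P] {X : ℕ → Ω → ℝ}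
    {Y : Ω → ℝ} (hX : ∀ n, HasGaussianLaw (X n) P) (hY : MemLp Y 2 P)
    (h : Tendsto (fun n => eLpNorm (X n - Y) 2 P) atTop (𝓝 0)) :
    HasGaussianLaw Y P := by
  have hX2 : ∀ n, MemLp (X n) 2 P := fun n => (hX n).memLp_two
  have hm := tendsto_integral_of_tendsto_eLpNorm_two hX2 hY h
  have hv := tendsto_variance_of_tendsto_eLpNorm_two hX2 hY h
  have hd := (tendstoInMeasure_of_tendsto_eLpNorm two_ne_zero
    (fun n => (hX2 n).aestronglyMeasurable) hY.aestronglyMeasurable h).tendstoInDistribution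
    fun n => (hX n).aemeasurable
  have hc := ProbabilityMeasure.tendsto_iff_tendsto_charFun.1 hd.tendsto
  have hP : IsProbabilityMeasure (P.map Y) :=
    Measure.isProbabilityMeasure_map hY.aestronglyMeasurable.aemeasurable
  have key : P.map Y = gaussianReal P[Y] Var[Y; P].toNNReal := by
    refine Measure.ext_of_charFun (funext fun t => ?_)
    refine tendsto_nhds_unique (hc t) ?_
    simp only [ProbabilityMeasure.coe_mk, (hX _).map_eq_gaussianReal, charFun_gaussianReal,
      Real.coe_toNNReal _ (variance_nonneg _ _)]
    refine (Complex.continuous_exp.tendsto _).comp ?_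
    refine ((((Complex.continuous_ofReal.tendsto _).comp hm).const_mul _).mul_const _).sub
      ((((Complex.continuous_ofReal.tendsto _).comp hv).mul_const _).div_const _)
  exact ⟨by rw [key]; infer_instance⟩

lemma IsGaussianProcess.of_tendsto_eLpNorm_two {T : Type*} [IsProbabilityMeasure P]
    {X : ℕ → T → Ω → ℝ} {Y : T → Ω → ℝ} (hX : ∀ n, IsGaussianProcess (X n) P)
    (hY : ∀ t, MemLp (Y t) 2 P)
    (h : ∀ t, Tendsto (fun n => eLpNorm (X n t - Y t) 2 P) atTop (𝓝 0)) :
    IsGaussianProcess Y P where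
  hasGaussianLaw I := by
    classical
    have hm : AEMeasurable (fun ω => I.restrict (Y · ω)) P :=
      aemeasurable_pi_lambda _ fun i => (hY i).aestronglyMeasurable.aemeasurable
    -- Cramér–Wold: Gaussianity of a finite-dimensional marginal is tested on linear functionals,
    -- which are finite combinations of the coordinates and so preserve L² convergence.
    have hL : ∀ (L : (I → ℝ) →L[ℝ] ℝ) (Z : T → Ω → ℝ),
        (fun ω => L (I.restrict (Z · ω))) = ∑ i : I, L (Pi.single i 1) • Z i := by
      intro L Z
      ext ω
      have : I.restrict (Z · ω) = ∑ i : I, Z i ω • (Pi.single i 1 : I → ℝ) := by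
        ext j
        simp [Pi.single_apply]
      rw [this, map_sum]
      simp [mul_comm]
    refine ⟨isGaussian_of_isGaussian_map fun L => ?_⟩
    rw [AEMeasurable.map_map_of_aemeasurable (by fun_prop) hm]
    refine (HasGaussianLaw.of_tendsto_eLpNorm_two (X := fun n ω => L (I.restrict (X n · ω)))
      (fun n => ((hX n).hasGaussianLaw I).map_fun L) ?_ ?_).isGaussian_map
    · change MemLp (fun ω => L (I.restrict (Y · ω))) 2 P
      rw [hL]
      exact memLp_finsetSum' _ fun i _ => (hY i).const_smul _
    · have hz : Tendsto (fun n => ∑ i : I, ‖L (Pi.single i 1)‖ₑ * eLpNorm (X n i - Y i) 2 P)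
          atTop (𝓝 0) := by
        have := tendsto_finsetSum (Finset.univ : Finset I) fun i _ =>
          ENNReal.Tendsto.const_mul (a := ‖L (Pi.single i 1)‖ₑ) (h i) (Or.inr enorm_ne_top)
        simpa using this
      refine tendsto_of_tendsto_of_tendsto_of_le_of_le tendsto_const_nhds hz (fun _ => zero_le)
        fun n => ?_
      have e : ((fun ω => L (I.restrict (X n · ω))) - (⇑L ∘ fun ω => I.restrict (Y · ω))) =
          ∑ i : I, L (Pi.single i 1) • (X n i - Y i) := by
        change (fun ω => L (I.restrict (X n · ω))) - (fun ω => L (I.restrict (Y · ω))) = _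
        rw [hL, hL, ← Finset.sum_sub_distrib]
        simp [smul_sub]
      simp only
      rw [e]
      refine (eLpNorm_sum_le (fun i _ => ?_) one_le_two).trans
        (Finset.sum_le_sum fun i _ => (eLpNorm_const_smul_le).trans le_rfl)
      exact ((((hX n).hasGaussianLaw_eval i).memLp_two.sub (hY i)).const_smul _).aestronglyMeasurable

end Gaussian

/-! ### Step functions on uniform grids -/

lemma StepFunction.toFun_of_mem {t : ℝ≥0} (φ : StepFunction t) {i : ℕ} (hi : i < φ.n) {s : ℝ}
    (hs : s ∈ Set.Ioc (φ.τ i : ℝ) (φ.τ (i + 1))) : φ.toFun s = φ.c i := by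
  have hm : Monotone fun i => (φ.τ i : ℝ) := fun i j h => NNReal.coe_le_coe.2 (φ.mono h)
  rw [StepFunction.toFun, Finset.sum_eq_single_of_mem i (Finset.mem_range.2 hi),
    Set.indicator_of_mem hs]
  intro j _ hj
  exact Set.indicator_of_notMem
    (fun h => (Set.disjoint_left.1 (hm.pairwise_disjoint_on_Ioc_succ hj) h) hs) _

lemma StepFunction.measurable_toFun {t : ℝ≥0} (φ : StepFunction t) : Measurable φ.toFun :=
  Finset.measurable_fun_sum _ fun _ _ => measurable_const.indicator measurableSet_Ioc

/-- The `i`-th point of the subdivision of `[0, t]` into `n + 1` equal parts. -/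
noncomputable def gridPoint (t : ℝ≥0) (n i : ℕ) : ℝ≥0 := t * (min i (n + 1) : ℕ) / (n + 1 : ℕ)

lemma gridPoint_mono (t : ℝ≥0) (n : ℕ) : Monotone (gridPoint t n) := by
  intro i j h
  unfold gridPoint
  gcongr

/-- The truncation `min i (n + 1)` makes this true for every i, as `StepFunction` demands. -/
lemma gridPoint_le (t : ℝ≥0) (n i : ℕ) : gridPoint t n i ≤ t := by
  refine div_le_of_le_mul₀ zero_le zero_le ?_
  gcongr
  exact min_le_right _ _

lemma gridPoint_zero (t : ℝ≥0) (n : ℕ) : gridPoint t n 0 = 0 := by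
  simp [gridPoint]

lemma gridPoint_last (t : ℝ≥0) (n : ℕ) : gridPoint t n (n + 1) = t := by
  rw [gridPoint, min_self]
  exact mul_div_cancel_right₀ _ (Nat.cast_ne_zero.2 n.succ_ne_zero)

lemma gridPoint_succ (t : ℝ≥0) {n i : ℕ} (hi : i < n + 1) :
    gridPoint t n (i + 1) = gridPoint t n i + t / (n + 1 : ℕ) := by
  rw [gridPoint, gridPoint, min_eq_left hi.le, min_eq_left (Nat.succ_le_of_lt hi)]
  push_cast
  ring

/-- The step function with values `c i` on the uniform grid. -/
noncomputable def gridStep (t : ℝ≥0) (n : ℕ) (c : ℕ → ℝ) : StepFunction t where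
  n := n + 1
  τ := gridPoint t n
  mono := gridPoint_mono t n
  le := gridPoint_le t n
  c := c

lemma exists_mem_gridPoint {t : ℝ≥0} (n : ℕ) {s : ℝ} (hs : s ∈ Set.Ioc (0 : ℝ) t) :
    ∃ i < n + 1, s ∈ Set.Ioc (gridPoint t n i : ℝ) (gridPoint t n (i + 1)) := by
  have hm : Monotone fun i => (gridPoint t n i : ℝ) := fun i j h =>
    NNReal.coe_le_coe.2 (gridPoint_mono t n h)
  have h := hm.biUnion_Ico_Ioc_map_succ 0 (n + 1)
  simp only [gridPoint_zero, gridPoint_last, NNReal.coe_zero] at h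
  rw [← h] at hs
  simp only [Set.mem_iUnion₂] at hs
  obtain ⟨i, hi, his⟩ := hs
  exact ⟨i, hi.2, his⟩

/-- The grid point following `s`. -/
noncomputable def nextGridPoint (t : ℝ≥0) (n : ℕ) : ℝ → ℝ :=
  (gridStep t n fun i => gridPoint t n (i + 1)).toFun

lemma nextGridPoint_of_mem {t : ℝ≥0} {n i : ℕ} (hi : i < n + 1) {s : ℝ}
    (hs : s ∈ Set.Ioc (gridPoint t n i : ℝ) (gridPoint t n (i + 1))) :
    nextGridPoint t n s = gridPoint t n (i + 1) :=
  (gridStep t n fun i => gridPoint t n (i + 1)).toFun_of_mem hi hs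

lemma nextGridPoint_mem {t : ℝ≥0} (n : ℕ) {s : ℝ} (hs : s ∈ Set.Ioc (0 : ℝ) t) :
    nextGridPoint t n s ∈ Set.Icc s (s + t / (n + 1 : ℕ)) := by
  obtain ⟨i, hi, h⟩ := exists_mem_gridPoint n hs
  rw [nextGridPoint_of_mem hi h]
  refine ⟨h.2, ?_⟩
  rw [gridPoint_succ t hi]
  push_cast
  have := h.1.le
  gcongr

/-- By the mean value inequality the error is at most sup |g'| times the mesh, uniformly on (0, t].
-/
lemma tendsto_eLpNorm_gridStep {g g' : ℝ → ℝ} (hg : ∀ s, HasDerivAt g (g' s) s)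
    (hg' : Continuous g') (t : ℝ≥0) :
    Tendsto (fun n => eLpNorm (fun s => (gridStep t n fun i => g (gridPoint t n i)).toFun s - g s) 2
      (volume.restrict (Set.Icc (0 : ℝ) t))) atTop (𝓝 0) := by
  obtain ⟨M, hM⟩ := (isCompact_Icc (a := (0 : ℝ)) (b := t)).exists_bound_of_continuousOn
    hg'.continuousOn
  have hM0 : 0 ≤ M := (norm_nonneg _).trans (hM 0 ⟨le_rfl, t.coe_nonneg⟩)
  have hb : ∀ n : ℕ, eLpNorm
      (fun s => (gridStep t n fun i => g (gridPoint t n i)).toFun s - g s) 2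
      (volume.restrict (Set.Icc (0 : ℝ) t)) ≤
      (volume.restrict (Set.Icc (0 : ℝ) t)) Set.univ ^ (2 : ℝ≥0∞).toReal⁻¹ *
        ENNReal.ofReal (M * (t / (n + 1 : ℕ))) := by
    intro n
    refine eLpNorm_le_of_ae_bound ?_
    -- The cells are open on the left, so the step function vanishes at 0 and the bound may fail
    -- there.
    rw [restrict_Ioc_eq_restrict_Icc.symm, ae_restrict_iff' measurableSet_Ioc]
    refine Eventually.of_forall fun s hs => ?_
    obtain ⟨i, hi, h⟩ := exists_mem_gridPoint n hs
    rw [(gridStep t n fun i => g (gridPoint t n i)).toFun_of_mem hi h]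
    change ‖g (gridPoint t n i) - g s‖ ≤ _
    have hsub := (convex_Icc (0 : ℝ) t).norm_image_sub_le_of_norm_hasDerivWithin_le
      (fun x _ => (hg x).hasDerivWithinAt) hM ⟨hs.1.le, hs.2⟩
      ⟨(gridPoint t n i).coe_nonneg, NNReal.coe_le_coe.2 (gridPoint_le t n i)⟩
    refine hsub.trans (mul_le_mul_of_nonneg_left ?_ hM0)
    have h2 := h.2
    rw [gridPoint_succ t hi] at h2
    push_cast at h2 ⊢
    rw [Real.norm_eq_abs, abs_sub_comm, abs_of_nonneg (by linarith [h.1])]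
    linarith
  refine tendsto_of_tendsto_of_tendsto_of_le_of_le tendsto_const_nhds ?_ (fun _ => zero_le) hb
  have h0 : Tendsto (fun n : ℕ => M * ((t : ℝ) / (n + 1 : ℕ))) atTop (𝓝 0) := by
    have := (tendsto_const_div_atTop_nhds_zero_nat (t : ℝ)).comp (tendsto_add_atTop_nat 1)
    simpa using this.const_mul M
  have h1 := ENNReal.Tendsto.const_mul
    (a := (volume.restrict (Set.Icc (0 : ℝ) t)) Set.univ ^ (2 : ℝ≥0∞).toReal⁻¹)
    (ENNReal.tendsto_ofReal h0) (Or.inr (by simp))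
  simpa using h1

/-- Summation by parts for a Riemann-Stieltjes sum, with an explicit remainder. -/
lemma sum_gridPoint_sub {g g' b : ℝ → ℝ} (hg : ∀ s, HasDerivAt g (g' s) s)
    (hg' : Continuous g') (hb : Continuous b) (hb0 : b 0 = 0) (t : ℝ≥0) (n : ℕ) :
    ∑ i ∈ Finset.range (n + 1), g (gridPoint t n i) *
        (b (gridPoint t n (i + 1)) - b (gridPoint t n i)) -
      (g t * b t - ∫ s in (0 : ℝ)..t, g' s * b s) =
    ∫ s in (0 : ℝ)..t, g' s * (b s - b (nextGridPoint t n s)) := by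
  have hle : ∀ i, (gridPoint t n i : ℝ) ≤ gridPoint t n (i + 1) := fun i =>
    NNReal.coe_le_coe.2 (gridPoint_mono t n i.le_succ)
  have hcong : ∀ i < n + 1, Set.EqOn
      (fun s => g' s * (b s - b (gridPoint t n (i + 1))))
      (fun s => g' s * (b s - b (nextGridPoint t n s)))
      (Set.uIoc (gridPoint t n i : ℝ) (gridPoint t n (i + 1))) := by
    intro i hi s hs
    rw [Set.uIoc_of_le (hle i)] at hs
    simp only [nextGridPoint_of_mem hi hs]
  have hint : ∀ i, IntervalIntegrable (fun s => g' s * (b s - b (gridPoint t n (i + 1))))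
      volume (gridPoint t n i) (gridPoint t n (i + 1)) := fun i =>
    Continuous.intervalIntegrable (by fun_prop) _ _
  have hgb : Continuous fun s => g' s * b s := by fun_prop
  have h1 := intervalIntegral.sum_integral_adjacent_intervals
    (f := fun s => g' s * (b s - b (nextGridPoint t n s)))
    (a := fun i => (gridPoint t n i : ℝ)) (n := n + 1) (μ := volume)
    fun i hi => (intervalIntegrable_congr (hcong i hi)).1 (hint i)
  have h2 := intervalIntegral.sum_integral_adjacent_intervals (f := fun s => g' s * b s)
    (a := fun i => (gridPoint t n i : ℝ)) (n := n + 1) (μ := volume)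
    fun i _ => hgb.intervalIntegrable _ _
  -- Telescoping of g·b. Expanding each increment with g at the left endpoint leaves b at the right
  -- endpoint, whence `nextGridPoint` in the remainder.
  have h3 := Finset.sum_range_sub
    (fun i => g (gridPoint t n i) * b (gridPoint t n i)) (n + 1)
  simp only [gridPoint_zero, gridPoint_last, NNReal.coe_zero, hb0, mul_zero, sub_zero] at h1 h2 h3
  rw [← h1, ← h2, ← h3, sub_sub_eq_add_sub, ← Finset.sum_add_distrib, ← Finset.sum_sub_distrib]
  refine Finset.sum_congr rfl fun i hi => ?_
  rw [← intervalIntegral.integral_congr_ae (ae_of_all _ (hcong i (Finset.mem_range.1 hi)))]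
  have hgc : Continuous fun s => g' s * b (gridPoint t n (i + 1)) := by fun_prop
  simp only [mul_sub]
  rw [intervalIntegral.integral_sub (hgb.intervalIntegrable _ _)
    (hgc.intervalIntegrable _ _), intervalIntegral.integral_mul_const,
    intervalIntegral.integral_eq_sub_of_hasDerivAt (fun s _ => hg s)
      (hg'.intervalIntegrable _ _)]
  ring

/-! ### The Wiener integral of a continuously differentiable function -/

/-- The Cauchy-Schwarz inequality against the constant function. -/
lemma lintegral_sq_le_measure_mul {α : Type*} [MeasurableSpace α] (μ : Measure α)
    {h : α → ℝ≥0∞} (hh : AEMeasurable h μ) :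
    (∫⁻ x, h x ∂μ) ^ 2 ≤ μ Set.univ * ∫⁻ x, h x ^ 2 ∂μ := by
  have := ENNReal.lintegral_mul_le_Lp_mul_Lq μ Real.HolderConjugate.two_two
    (aemeasurable_const (b := (1 : ℝ≥0∞))) hh
  simp only [Pi.mul_apply, one_mul, ENNReal.rpow_two, lintegral_const, one_pow] at this
  calc (∫⁻ x, h x ∂μ) ^ 2
      ≤ (μ Set.univ ^ (1 / 2 : ℝ) * (∫⁻ x, h x ^ 2 ∂μ) ^ (1 / 2 : ℝ)) ^ 2 := by gcongr
    _ = μ Set.univ * ∫⁻ x, h x ^ 2 ∂μ := by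
        rw [mul_pow, ← ENNReal.rpow_mul_natCast, ← ENNReal.rpow_mul_natCast]
        norm_num

section Path

variable {Ω : Type*} {B C : ℝ≥0 → Ω → ℝ}

/-- The path `s ↦ B s - B 0`, extended by zero to negative times. -/
def centeredPath (B : ℝ≥0 → Ω → ℝ) (ω : Ω) (s : ℝ) : ℝ := B s.toNNReal ω - B 0 ω

lemma continuous_centeredPath {ω : Ω} (h : Continuous fun t => B t ω) :
    Continuous (centeredPath B ω) :=
  (h.comp continuous_real_toNNReal).sub continuous_const

lemma centeredPath_zero (B : ℝ≥0 → Ω → ℝ) (ω : Ω) : centeredPath B ω 0 = 0 := by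
  simp [centeredPath]

lemma centeredPath_coe (B : ℝ≥0 → Ω → ℝ) (ω : Ω) (t : ℝ≥0) :
    centeredPath B ω t = B t ω - B 0 ω := by
  simp [centeredPath]

/-- The Wiener integral `∫₀ᵗ g dB` after integration by parts, `g'` being the derivative of `g`. -/
noncomputable def wienerByParts (B : ℝ≥0 → Ω → ℝ) (g g' : ℝ → ℝ) (t : ℝ≥0) (ω : Ω) : ℝ :=
  g t * centeredPath B ω t - ∫ s in (0 : ℝ)..t, g' s * centeredPath B ω s

lemma wienerByParts_congr {ω : Ω} (h : ∀ t, C t ω = B t ω) (g g' : ℝ → ℝ) (t : ℝ≥0) :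
    wienerByParts C g g' t ω = wienerByParts B g g' t ω := by
  simp [wienerByParts, centeredPath, h]

lemma integral_gridStep_sub_wienerByParts {g g' : ℝ → ℝ} (hg : ∀ s, HasDerivAt g (g' s) s)
    (hg' : Continuous g') {ω : Ω} (hC : Continuous fun t => C t ω) (t : ℝ≥0) (n : ℕ) :
    (gridStep t n fun i => g (gridPoint t n i)).integral C ω - wienerByParts C g g' t ω =
      ∫ s in (0 : ℝ)..t, g' s * (C s.toNNReal ω - C (nextGridPoint t n s).toNNReal ω) := by
  have h := sum_gridPoint_sub hg hg' (continuous_centeredPath hC) (centeredPath_zero C ω) t n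
  simp only [centeredPath_coe, sub_sub_sub_cancel_right] at h
  simp only [centeredPath, sub_sub_sub_cancel_right] at h
  rw [← h]
  simp [StepFunction.integral, gridStep, wienerByParts, centeredPath]

lemma StepFunction.integral_eq_clm {t : ℝ≥0} (φ : StepFunction t) (B : ℝ≥0 → Ω → ℝ) :
    ∃ I : Finset ℝ≥0, ∃ L : (I → ℝ) →L[ℝ] ℝ, ∀ ω, φ.integral B ω = L (I.restrict (B · ω)) := by
  classical
  let I : Finset ℝ≥0 := (Finset.range (φ.n + 1)).image φ.τ
  have hI : ∀ i ≤ φ.n, φ.τ i ∈ I := fun i hi =>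
    Finset.mem_image_of_mem _ (Finset.mem_range.2 (Nat.lt_succ_of_le hi))
  refine ⟨I, ∑ i : Fin φ.n, φ.c i • (ContinuousLinearMap.proj ⟨φ.τ (i + 1), hI _ i.2⟩ -
    ContinuousLinearMap.proj ⟨φ.τ i, hI _ i.2.le⟩), fun ω => ?_⟩
  simp [StepFunction.integral, Finset.sum_range]

end Path

section Wiener

variable {Ω : Type*} [MeasurableSpace Ω] {P : Measure Ω} {B C : ℝ≥0 → Ω → ℝ}

lemma lintegral_enorm_sub_sq [IsProbabilityMeasure P] (hB : IsPreBrownianReal B P) (s t : ℝ≥0) :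
    ∫⁻ ω, ‖B s ω - B t ω‖ₑ ^ 2 ∂P = nndist (s : ℝ) t := by
  have hl := hB.hasLaw_sub s t
  have h2 : MemLp (B s - B t) 2 P := hl.hasGaussianLaw.memLp_two
  have hm : P[B s - B t] = 0 := by rw [hl.integral_eq, integral_id_gaussianReal]
  have hv : Var[B s - B t; P] = nndist (s : ℝ) t := by
    rw [hl.variance_eq, variance_id_gaussianReal]; rfl
  have h := h2.ofReal_variance_eq
  rw [hv, evariance, hm] at h
  simpa [edist_dist] using h.symm

/-- Cauchy–Schwarz in time moves the square inside, Tonelli exchanges the integrals, and a Brownian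
increment over at most one mesh has second moment at most t/(n + 1). -/
lemma lintegral_stieltjes_remainder_le [IsProbabilityMeasure P] (hC : IsPreBrownianReal C P)
    (hcont : ∀ ω, Continuous fun t => C t ω) (hmeas : ∀ t, Measurable (C t)) {g' : ℝ → ℝ}
    (hg' : Continuous g') {t : ℝ≥0} {M : ℝ≥0} (hM : ∀ s ∈ Set.Icc (0 : ℝ) t, ‖g' s‖ₑ ≤ M)
    (n : ℕ) :
    ∫⁻ ω, ‖∫ s in (0 : ℝ)..t, g' s * (C s.toNNReal ω - C (nextGridPoint t n s).toNNReal ω)‖ₑ ^ 2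
      ∂P ≤ (t * (M ^ 2 * (t / (n + 1 : ℕ)) * t) : ℝ≥0) := by
  have hu : Measurable (Function.uncurry C) :=
    measurable_uncurry_of_continuous_of_measurable hcont hmeas
  have hR : Measurable (nextGridPoint t n) := StepFunction.measurable_toFun _
  have hF : Measurable fun p : Ω × ℝ =>
      ‖g' p.2 * (C p.2.toNNReal p.1 - C (nextGridPoint t n p.2).toNNReal p.1)‖ₑ := by
    have h1 : Measurable fun p : Ω × ℝ => C p.2.toNNReal p.1 :=
      hu.comp (measurable_snd.real_toNNReal.prodMk measurable_fst)
    have h2 : Measurable fun p : Ω × ℝ => C (nextGridPoint t n p.2).toNNReal p.1 :=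
      hu.comp ((hR.comp measurable_snd).real_toNNReal.prodMk measurable_fst)
    exact ((hg'.measurable.comp measurable_snd).mul (h1.sub h2)).enorm
  set μ : Measure ℝ := volume.restrict (Set.Ioc (0 : ℝ) t) with hμ
  have hμt : μ Set.univ = t := by simp [hμ]
  have hpt : ∀ ω, ‖∫ s in (0 : ℝ)..t,
      g' s * (C s.toNNReal ω - C (nextGridPoint t n s).toNNReal ω)‖ₑ ^ 2 ≤
      t * ∫⁻ s, ‖g' s * (C s.toNNReal ω - C (nextGridPoint t n s).toNNReal ω)‖ₑ ^ 2 ∂μ := by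
    intro ω
    rw [intervalIntegral.integral_of_le t.coe_nonneg, ← hμt]
    refine le_trans ?_ (lintegral_sq_le_measure_mul μ
      (hF.comp (measurable_const.prodMk measurable_id)).aemeasurable)
    gcongr
    exact enorm_integral_le_lintegral_enorm _
  have hs : ∀ s ∈ Set.Ioc (0 : ℝ) t,
      ∫⁻ ω, ‖g' s * (C s.toNNReal ω - C (nextGridPoint t n s).toNNReal ω)‖ₑ ^ 2 ∂P ≤
      (M ^ 2 * (t / (n + 1 : ℕ)) : ℝ≥0) := by
    intro s hs
    simp only [enorm_mul, mul_pow]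
    rw [lintegral_const_mul' _ _ (by finiteness), lintegral_enorm_sub_sq hC, ENNReal.coe_mul,
      ENNReal.coe_pow]
    gcongr
    · exact hM s ⟨hs.1.le, hs.2⟩
    · have h := nextGridPoint_mem n hs
      rw [← NNReal.coe_le_coe, coe_nndist, Real.coe_toNNReal _ hs.1.le,
        Real.coe_toNNReal _ (hs.1.le.trans h.1), Real.dist_eq, abs_sub_comm,
        abs_of_nonneg (by linarith [h.1])]
      have := h.2
      push_cast at this ⊢
      linarith
  calc _ ≤ ∫⁻ ω, t * ∫⁻ s,
        ‖g' s * (C s.toNNReal ω - C (nextGridPoint t n s).toNNReal ω)‖ₑ ^ 2 ∂μ ∂P :=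
        lintegral_mono hpt
    _ = t * ∫⁻ s, ∫⁻ ω,
        ‖g' s * (C s.toNNReal ω - C (nextGridPoint t n s).toNNReal ω)‖ₑ ^ 2 ∂P ∂μ := by
        rw [lintegral_const_mul' _ _ ENNReal.coe_ne_top,
          lintegral_lintegral_swap (hF.pow_const 2).aemeasurable]
    _ ≤ t * ∫⁻ _, (M ^ 2 * (t / (n + 1 : ℕ)) : ℝ≥0) ∂μ := by
        gcongr (t : ℝ≥0∞) * ?_
        exact setLIntegral_mono' measurableSet_Ioc hs
    _ = _ := by
        rw [lintegral_const, hμt, ← ENNReal.coe_mul, ← ENNReal.coe_mul]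

lemma tendsto_eLpNorm_integral_gridStep_of_continuous [IsProbabilityMeasure P]
    (hC : IsPreBrownianReal C P) (hcont : ∀ ω, Continuous fun t => C t ω)
    (hmeas : ∀ t, Measurable (C t)) {g g' : ℝ → ℝ} (hg : ∀ s, HasDerivAt g (g' s) s)
    (hg' : Continuous g') (t : ℝ≥0) :
    Tendsto (fun n => eLpNorm (fun ω =>
      (gridStep t n fun i => g (gridPoint t n i)).integral C ω - wienerByParts C g g' t ω) 2 P)
      atTop (𝓝 0) := by
  obtain ⟨M, hM⟩ := (isCompact_Icc (a := (0 : ℝ)) (b := t)).exists_bound_of_continuousOn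
    hg'.continuousOn
  have hM' : ∀ s ∈ Set.Icc (0 : ℝ) t, ‖g' s‖ₑ ≤ M.toNNReal := fun s hs => by
    rw [← ofReal_norm]
    exact ENNReal.ofReal_le_ofReal (hM s hs)
  have h0 : Tendsto (fun n : ℕ => t * (M.toNNReal ^ 2 * (t / (n + 1 : ℕ)) * t)) atTop (𝓝 0) := by
    have := (tendsto_const_div_atTop_nhds_zero_nat t).comp (tendsto_add_atTop_nat 1)
    simpa using ((this.const_mul (M.toNNReal ^ 2)).mul_const t).const_mul t
  have h1 := tendsto_of_tendsto_of_tendsto_of_le_of_le tendsto_const_nhds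
    (ENNReal.tendsto_coe.2 h0) (fun _ => zero_le)
    fun n => lintegral_stieltjes_remainder_le hC hcont hmeas hg' hM' n
  have h2 := (ENNReal.continuous_rpow_const (y := 1 / 2)).tendsto _ |>.comp h1
  simp only [ENNReal.coe_zero] at h2
  rw [ENNReal.zero_rpow_of_pos (by norm_num)] at h2
  refine h2.congr fun n => ?_
  rw [eLpNorm_eq_lintegral_rpow_enorm_toReal two_ne_zero ENNReal.ofNat_ne_top]
  simp [integral_gridStep_sub_wienerByParts hg hg' (hcont _)]

/-- Discontinuous paths form a null set, measurable by completeness, and are replaced by zero.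
Continuity of every path gives the joint measurability that Tonelli requires. -/
lemma exists_continuous_version [P.IsComplete] (hB : IsBrownianReal B P) :
    ∃ C : ℝ≥0 → Ω → ℝ, (∀ ω, Continuous fun t => C t ω) ∧ (∀ t, Measurable (C t)) ∧
      ∀ᵐ ω ∂P, ∀ t, C t ω = B t ω := by
  classical
  have hS : MeasurableSet {ω | Continuous fun t => B t ω} :=
    (Measure.IsComplete.out' _ (ae_iff.1 hB.cont)).of_compl
  refine ⟨fun t => {ω | Continuous fun t => B t ω}.indicator (B t), fun ω => ?_, fun t => ?_, ?_⟩
  · by_cases h : Continuous fun t => B t ω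
    · simp [Set.indicator, h]
    · simpa [Set.indicator, h] using continuous_const
  · exact ((hB.aemeasurable t).nullMeasurable.measurable_of_complete).indicator hS
  · filter_upwards [hB.cont] with ω hω t
    exact Set.indicator_of_mem (s := {ω | Continuous fun t => B t ω}) hω _

lemma tendsto_eLpNorm_integral_gridStep [IsProbabilityMeasure P] [P.IsComplete]
    (hB : IsBrownianReal B P) {g g' : ℝ → ℝ} (hg : ∀ s, HasDerivAt g (g' s) s)
    (hg' : Continuous g') (t : ℝ≥0) :
    Tendsto (fun n => eLpNorm (fun ω =>
      (gridStep t n fun i => g (gridPoint t n i)).integral B ω - wienerByParts B g g' t ω) 2 P)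
      atTop (𝓝 0) := by
  obtain ⟨C, hcont, hmeas, hCB⟩ := exists_continuous_version hB
  have hC : IsPreBrownianReal C P := hB.toIsPreBrownianReal.congr fun t =>
    hCB.mono fun ω hω => (hω t).symm
  refine (tendsto_eLpNorm_integral_gridStep_of_continuous hC hcont hmeas hg hg' t).congr
    fun n => eLpNorm_congr_ae ?_
  filter_upwards [hCB] with ω hω
  simp [StepFunction.integral, wienerByParts_congr hω, hω]

lemma measurable_wienerByParts [P.IsComplete] (hB : IsBrownianReal B P) {g g' : ℝ → ℝ}
    (hg' : Continuous g') (t : ℝ≥0) :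
    Measurable (wienerByParts B g g' t) := by
  obtain ⟨C, hcont, hmeas, hCB⟩ := exists_continuous_version hB
  have hu : Measurable fun p : ℝ × Ω => g' p.1 * centeredPath C p.2 p.1 := by
    have h1 := (measurable_uncurry_of_continuous_of_measurable hcont hmeas).comp
      ((measurable_fst (α := ℝ) (β := Ω)).real_toNNReal.prodMk measurable_snd)
    exact (hg'.measurable.comp measurable_fst).mul (h1.sub ((hmeas 0).comp measurable_snd))
  have hm : Measurable (wienerByParts C g g' t) := by
    refine (((hmeas _).sub (hmeas 0)).const_mul _).sub ?_
    simp only [intervalIntegral.integral_of_le t.coe_nonneg]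
    exact (hu.stronglyMeasurable.integral_prod_left
      (f := fun s ω => g' s * centeredPath C ω s)).measurable
  have hae : AEMeasurable (wienerByParts B g g' t) P :=
    hm.aemeasurable.congr (hCB.mono fun ω hω => wienerByParts_congr hω g g' t)
  exact hae.nullMeasurable.measurable_of_complete

end Wiener

/-! ### Measurability up to null sets -/

section Null

variable {Ω : Type*} {m m₀ : MeasurableSpace Ω} {P : Measure[m₀] Ω}

/-- An almost sure limit is measurable for a sub-σ-algebra that contains all null sets. -/
lemma measurable_of_tendsto_ae_of_null (hm : m ≤ m₀) (hnull : ∀ N, P N = 0 → MeasurableSet[m] N)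
    {X : ℕ → Ω → ℝ} {Y : Ω → ℝ} (hX : ∀ n, Measurable[m] (X n))
    (h : ∀ᵐ ω ∂P, Tendsto (fun n => X n ω) atTop (𝓝 (Y ω))) : Measurable[m] Y := by
  -- Since m contains the null sets, restricting P to m gives a complete measure, for which almost
  -- everywhere measurable functions are measurable.
  have hc : (P.trim hm).IsComplete :=
    ⟨fun N hN => hnull N (measure_eq_zero_of_trim_eq_zero hm hN)⟩
  have h' : ∀ᵐ ω ∂(P.trim hm), Tendsto (fun n => X n ω) atTop (𝓝 (Y ω)) := by
    rw [ae_iff] at h ⊢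
    rw [trim_measurableSet_eq hm (hnull _ h), h]
  have hY := @aemeasurable_of_tendsto_metrizable_ae Ω ℝ m _ _ _ _ ℕ (P.trim hm) X Y atTop _ _
    (fun n => (hX n).aemeasurable) h'
  exact NullMeasurable.measurable_of_complete (m0 := m) (AEMeasurable.nullMeasurable hY)

end Null

/-! ### Adaptedness and Gaussianity of Wiener integrals -/

section Solution

variable {Ω : Type*} [MeasurableSpace Ω] {P : Measure Ω} {B : ℝ≥0 → Ω → ℝ}

lemma measurable_brownianFiltration [P.IsComplete] (hB : IsBrownianReal B P) {s t : ℝ≥0}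
    (hst : s ≤ t) : Measurable[brownianFiltration hB t] (B s) := by
  rw [measurable_iff_comap_le, BorelSpace.measurable_eq (α := ℝ)]
  exact le_sup_of_le_left (le_iSup₂ (f := fun s _ => MeasurableSpace.comap (B s) (borel ℝ)) s hst)

lemma measurableSet_brownianFiltration_of_null [P.IsComplete] (hB : IsBrownianReal B P)
    (t : ℝ≥0) {N : Set Ω} (hN : P N = 0) : MeasurableSet[brownianFiltration hB t] N :=
  (le_sup_right : MeasurableSpace.generateFrom {N : Set Ω | P N = 0} ≤
    brownianFiltration hB t) N (MeasurableSpace.measurableSet_generateFrom hN)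

lemma StepFunction.measurable_integral [P.IsComplete] (hB : IsBrownianReal B P) {t : ℝ≥0}
    (φ : StepFunction t) : Measurable[brownianFiltration hB t] (φ.integral B) := by
  refine Finset.measurable_fun_sum _ fun i _ => Measurable.const_mul (Measurable.sub ?_ ?_) _
  · exact measurable_brownianFiltration hB (φ.le _)
  · exact measurable_brownianFiltration hB (φ.le _)

lemma StepFunction.hasGaussianLaw_integral (hB : IsGaussianProcess B P) {t : ℝ≥0}
    (φ : StepFunction t) : HasGaussianLaw (φ.integral B) P := by
  obtain ⟨I, L, hL⟩ := φ.integral_eq_clm B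
  rw [show φ.integral B = fun ω => L (I.restrict (B · ω)) from funext hL]
  exact (hB.hasGaussianLaw I).map_fun L

lemma HasWienerIntegral.congr {g : ℝ → ℝ} {t : ℝ≥0} {X Y : Ω → ℝ} (h : HasWienerIntegral B P t g X)
    (hXY : X =ᵐ[P] Y) : HasWienerIntegral B P t g Y := by
  obtain ⟨h1, h2, φ, h3, h4⟩ := h
  refine ⟨h1, h2.ae_eq hXY, φ, h3, h4.congr fun n => eLpNorm_congr_ae ?_⟩
  filter_upwards [hXY] with ω hω
  rw [hω]

/-- A process of Wiener integrals of deterministic functions is Gaussian. -/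
lemma isGaussianProcess_of_hasWienerIntegral [IsProbabilityMeasure P]
    (hB : IsGaussianProcess B P) {G : ℝ≥0 → ℝ → ℝ} {X : ℝ≥0 → Ω → ℝ} (h : ∀ t, HasWienerIntegral B P t (G t) (X t)) :
    IsGaussianProcess X P := by
  -- The approximations are chosen independently for each t. For fixed n each elementary integral is
  -- still linear in finitely many values of B, so they form a Gaussian process in t.
  choose _ h2 φ _ h4 using h
  exact IsGaussianProcess.of_tendsto_eLpNorm_two (X := fun n t => (φ t n).integral B)
    (fun n => hB.of_isGaussianProcess fun t => (φ t n).integral_eq_clm B) h2 h4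

variable [IsProbabilityMeasure P] [P.IsComplete] {g g' : ℝ → ℝ}

/-- The elementary integrals use B only up to time t; a subsequence of them converges almost surely,
and the filtration contains the null sets. -/
lemma measurable_brownianFiltration_wienerByParts (hB : IsBrownianReal B P)
    (hg : ∀ s, HasDerivAt g (g' s) s) (hg' : Continuous g') (t : ℝ≥0) :
    Measurable[brownianFiltration hB t] (wienerByParts B g g' t) := by
  have hle := (brownianFiltration hB).le t
  have hS := fun n => (gridStep t n fun i => g (gridPoint t n i)).measurable_integral hB
  obtain ⟨ns, -, h⟩ := (tendstoInMeasure_of_tendsto_eLpNorm two_ne_zero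
    (fun n => ((hS n).mono hle le_rfl).aestronglyMeasurable)
    (measurable_wienerByParts hB hg' t).aestronglyMeasurable
    (tendsto_eLpNorm_integral_gridStep hB hg hg' t)).exists_seq_tendsto_ae
  exact measurable_of_tendsto_ae_of_null hle
    (fun N hN => measurableSet_brownianFiltration_of_null hB t hN) (fun n => hS (ns n)) h

lemma hasWienerIntegral_wienerByParts (hB : IsBrownianReal B P)
    (hg : ∀ s, HasDerivAt g (g' s) s) (hg' : Continuous g') (t : ℝ≥0) :
    HasWienerIntegral B P t g (wienerByParts B g g' t) := by
  have hgc : Continuous g := continuous_iff_continuousAt.2 fun s => (hg s).continuousAt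
  have hlim := tendsto_eLpNorm_integral_gridStep hB hg hg' t
  refine ⟨?_, ?_, _, tendsto_eLpNorm_gridStep hg hg' t, hlim⟩
  · obtain ⟨M, hM⟩ := (isCompact_Icc (a := (0 : ℝ)) (b := t)).exists_bound_of_continuousOn
      hgc.continuousOn
    exact MemLp.of_bound hgc.aestronglyMeasurable M
      ((ae_restrict_iff' measurableSet_Icc).2 (Eventually.of_forall hM))
  -- Square integrability: some elementary integral, itself Gaussian, lies at finite L² distance.
  · obtain ⟨n, hn⟩ := (hlim.eventually_lt_const ENNReal.zero_lt_top).exists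
    have hφ := ((gridStep t n fun i => g (gridPoint t n i)).hasGaussianLaw_integral
      hB.isGaussianProcess).memLp_two
    have hJ := (measurable_wienerByParts (g := g) hB hg' t).aestronglyMeasurable (μ := P)
    have := hφ.sub (⟨hφ.aestronglyMeasurable.sub hJ, hn⟩ : MemLp (fun ω =>
      (gridStep t n fun i => g (gridPoint t n i)).integral B ω - wienerByParts B g g' t ω) 2 P)
    refine this.ae_eq (Eventually.of_forall fun ω => ?_)
    simp

/-! ### The strong solution -/

/-- Two strong solutions are indistinguishable. -/
lemma IsStrongSolution.ae_eq {Ω : Type*} [MeasurableSpace Ω] {P : Measure Ω} {B : ℝ≥0 → Ω → ℝ}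
    {𝓕 : Filtration ℝ≥0 ‹_›} {f v w : ℝ → ℝ} {x ξ x' ξ' : ℝ≥0 → Ω → ℝ}
    (hv : SolvesHomogeneous f v) (hw : SolvesHomogeneous f w) (hvw : ∀ t, wronskian v w t = 1)
    (hf : Continuous f) (h : IsStrongSolution f B P 𝓕 x ξ)
    (h' : IsStrongSolution f B P 𝓕 x' ξ') : ∀ᵐ ω ∂P, ∀ t, x' t ω = x t ω ∧ ξ' t ω = ξ t ω := by
  filter_upwards [h.continuous_x, h.continuous_ξ, h.eq_x, h.eq_ξ, h'.continuous_x,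
    h'.continuous_ξ, h'.eq_x, h'.eq_ξ] with ω hx hξ ex eξ hx' hξ' ex' eξ' t
  have key := eq_of_eq_integral_add (b := centeredPath B ω)
    (x := fun s => x s.toNNReal ω) (ξ := fun s => ξ s.toNNReal ω)
    (x' := fun s => x' s.toNNReal ω) (ξ' := fun s => ξ' s.toNNReal ω) hv hw hvw hf
    (hx.comp continuous_real_toNNReal) (hξ.comp continuous_real_toNNReal)
    (hx'.comp continuous_real_toNNReal) (hξ'.comp continuous_real_toNNReal)
    (fun s hs => ?_) (fun s hs => ?_) (fun s hs => ?_) (fun s hs => ?_) t.coe_nonneg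
  · simpa using key
  all_goals lift s to ℝ≥0 using hs
  · simpa using ex s
  · simpa [centeredPath_coe] using eξ s
  · simpa using ex' s
  · simpa [centeredPath_coe] using eξ' s

/-- The first component of the strong solution. -/
noncomputable def solutionPosition (v w : ℝ → ℝ) (B : ℝ≥0 → Ω → ℝ) (t : ℝ≥0) (ω : Ω) : ℝ :=
  variationPosition v w (centeredPath B ω) t

/-- The second component of the strong solution. -/
noncomputable def solutionVelocity (v w : ℝ → ℝ) (B : ℝ≥0 → Ω → ℝ) (t : ℝ≥0) (ω : Ω) : ℝ :=
  variationVelocity v w (centeredPath B ω) t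

lemma solutionPosition_eq {Ω : Type*} (v w : ℝ → ℝ) (B : ℝ≥0 → Ω → ℝ) (t : ℝ≥0) (ω : Ω) :
    solutionPosition v w B t ω =
      w t * wienerByParts B v (deriv v) t ω - v t * wienerByParts B w (deriv w) t ω := by
  simp only [solutionPosition, variationPosition, wienerByParts]
  ring

/-- The free term b in the velocity is b times the Wronskian, which supplies both boundary terms of
the integrations by parts. This form yields adaptedness. -/
lemma solutionVelocity_eq {Ω : Type*} {v w : ℝ → ℝ} (hvw : ∀ t, wronskian v w t = 1)
    (B : ℝ≥0 → Ω → ℝ) (t : ℝ≥0) (ω : Ω) :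
    solutionVelocity v w B t ω = deriv w t * wienerByParts B v (deriv v) t ω -
      deriv v t * wienerByParts B w (deriv w) t ω := by
  have := hvw t
  simp only [wronskian] at this
  simp only [solutionVelocity, variationVelocity, wienerByParts]
  linear_combination -centeredPath B ω t * this

lemma isStrongSolution_solution (hB : IsBrownianReal B P) {f v w : ℝ → ℝ}
    (hv : SolvesHomogeneous f v) (hw : SolvesHomogeneous f w) (hvw : ∀ t, wronskian v w t = 1)
    (hf : Continuous f) :
    IsStrongSolution f B P (brownianFiltration hB) (solutionPosition v w B)
      (solutionVelocity v w B) := by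
  have hJv := measurable_brownianFiltration_wienerByParts hB hv.hasDerivAt hv.continuous_deriv
  have hJw := measurable_brownianFiltration_wienerByParts hB hw.hasDerivAt hw.continuous_deriv
  have hpos : ∀ {t : ℝ≥0} {s : ℝ}, s ∈ Set.uIcc (0 : ℝ) t → (s.toNNReal : ℝ) = s := by
    intro t s hs
    rw [Set.uIcc_of_le t.coe_nonneg] at hs
    exact Real.coe_toNNReal _ hs.1
  refine ⟨fun t => ?_, fun t => ?_, ?_, ?_, ?_, ?_, ?_, ?_⟩
  · rw [funext (solutionPosition_eq v w B t)]
    exact Measurable.sub ((hJv t).const_mul _) ((hJw t).const_mul _)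
  · rw [funext (solutionVelocity_eq hvw B t)]
    exact Measurable.sub ((hJv t).const_mul _) ((hJw t).const_mul _)
  · filter_upwards [hB.cont] with ω hω
    exact (continuous_variationPosition hv hw hvw (continuous_centeredPath hω)).comp
      NNReal.continuous_coe
  · filter_upwards [hB.cont] with ω hω
    exact (continuous_variationVelocity hv hw (continuous_centeredPath hω)).comp
      NNReal.continuous_coe
  · exact Eventually.of_forall fun ω => by simp [solutionPosition, variationPosition]
  · exact Eventually.of_forall fun ω => by
      simp [solutionVelocity, variationVelocity, centeredPath_zero]
  · filter_upwards [hB.cont] with ω hω t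
    simp only [solutionPosition, solutionVelocity]
    rw [variationPosition_eq_integral hv hw hvw (continuous_centeredPath hω)]
    exact intervalIntegral.integral_congr fun s hs => by simp only [hpos hs]
  · filter_upwards [hB.cont] with ω hω t
    simp only [solutionPosition, solutionVelocity]
    rw [variationVelocity_eq_integral hf hv hw hvw (continuous_centeredPath hω),
      centeredPath_coe]
    congr 1
    exact intervalIntegral.integral_congr fun s hs => by simp only [hpos hs]

/-- For fixed t the kernel is C¹ in s and vanishes at s = t, so integration by parts has no boundary
term and gives `variationPosition` directly. -/
lemma hasWienerIntegral_kernelK (hB : IsBrownianReal B P) {f v w : ℝ → ℝ}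
    (hv : SolvesHomogeneous f v) (hw : SolvesHomogeneous f w) (t : ℝ≥0) :
    HasWienerIntegral B P t (fun s => kernelK v w t s) (solutionPosition v w B t) := by
  have hvc := hv.continuous_deriv
  have hwc := hw.continuous_deriv
  refine (hasWienerIntegral_wienerByParts hB (g' := fun s => w t * deriv v s - v t * deriv w s)
    (fun s => ((hv.hasDerivAt s).const_mul _).sub ((hw.hasDerivAt s).const_mul _))
    (by fun_prop) t).congr ?_
  filter_upwards [hB.cont] with ω hω
  have hb := continuous_centeredPath hω
  have h1 : Continuous fun s => w t * (deriv v s * centeredPath B ω s) := by fun_prop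
  have h2 : Continuous fun s => v t * (deriv w s * centeredPath B ω s) := by fun_prop
  simp only [wienerByParts, solutionPosition, variationPosition, sub_mul, mul_assoc, Pi.sub_apply]
  rw [intervalIntegral.integral_sub (h1.intervalIntegrable _ _) (h2.intervalIntegrable _ _),
    intervalIntegral.integral_const_mul, intervalIntegral.integral_const_mul]
  ring

end Solution

end StochasticLame

theorem mainTheorem1 {Ω : Type*} [MeasurableSpace Ω] (P : Measure Ω)
    [IsProbabilityMeasure P] [P.IsComplete]
    (B : ℝ≥0 → Ω → ℝ) (hB : IsBrownianReal B P)
    (a c y : ℝ) (hc : c < 0) (ha : 0 < a) (hcb : c < -a - c) (hba : -a - c < a)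
    (hy : y ∈ Set.Icc c (-a - c))
    (κ₁ κ₂ : ℝ)
    (hκ : κ₁ * κ₂ * (-(√((a - c) / 6) * (1 - modulus a c ^ 2) ^ 2)) = 1) :
    -- the two explicit functions solve the homogeneous equation and have Wronskian one
    (SolvesHomogeneous (x₀ a c y) (w₁ a c y κ₁) ∧
      SolvesHomogeneous (x₀ a c y) (w₂ a c y κ₂) ∧
      ∀ t, wronskian (w₁ a c y κ₁) (w₂ a c y κ₂) t = 1) ∧
    ∃ x ξ : ℝ≥0 → Ω → ℝ,
      -- existence of a strong solution
      IsStrongSolution (x₀ a c y) B P (brownianFiltration hB) x ξ ∧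
      -- uniqueness up to indistinguishability
      (∀ x' ξ' : ℝ≥0 → Ω → ℝ,
        IsStrongSolution (x₀ a c y) B P (brownianFiltration hB) x' ξ' →
        ∀ᵐ ω ∂P, ∀ t, x' t ω = x t ω ∧ ξ' t ω = ξ t ω) ∧
      -- the solution is a continuous Gaussian process
      (∀ᵐ ω ∂P, Continuous fun t => x t ω) ∧
      IsGaussianProcess x P ∧
      -- the two forms of the explicit representation by Wiener integrals
      (∀ t : ℝ≥0, ∃ I₁ I₂ : Ω → ℝ,
        HasWienerIntegral B P t (w₁ a c y κ₁) I₁ ∧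
        HasWienerIntegral B P t (w₂ a c y κ₂) I₂ ∧
        ∀ᵐ ω ∂P, x t ω = w₂ a c y κ₂ t * I₁ ω - w₁ a c y κ₁ t * I₂ ω) ∧
      (∀ t : ℝ≥0, HasWienerIntegral B P t
        (fun s => kernelK (w₁ a c y κ₁) (w₂ a c y κ₂) t s) (x t)) := by
  have hv := solvesHomogeneous_w₁ hcb hba y κ₁
  have hw := solvesHomogeneous_w₂ hcb hba y κ₂
  have hvw : ∀ t, wronskian (w₁ a c y κ₁) (w₂ a c y κ₂) t = 1 := fun t =>
    (wronskian_w₁_w₂ hcb hba y κ₁ κ₂ t).trans hκ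
  have hf := continuous_x₀ hcb hba y
  have hsol := isStrongSolution_solution hB hv hw hvw hf
  have hK := hasWienerIntegral_kernelK hB hv hw
  refine ⟨⟨hv, hw, hvw⟩, _, _, hsol, fun x' ξ' h' => hsol.ae_eq hv hw hvw hf h',
    hsol.continuous_x, isGaussianProcess_of_hasWienerIntegral hB.isGaussianProcess hK,
    fun t => ⟨_, _, hasWienerIntegral_wienerByParts hB hv.hasDerivAt hv.continuous_deriv t,
      hasWienerIntegral_wienerByParts hB hw.hasDerivAt hw.continuous_deriv t,
      Eventually.of_forall (solutionPosition_eq _ _ B t)⟩, hK⟩
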